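/- Theorem. Let $n\ge 0$ be an integer, let $M$ be a smooth Hausdorff manifold of dimension $2n+1$ and let $\alpha\in\mathbb R$. Let $(\phi,\xi,\eta,g)$ be a smooth almost contact metric structure on $M$, that is, a $(1,1)$-tensor field $\phi$, a vector field $\xi$, a $1$-form $\eta$ and a Riemannian metric $g$ with $\phi^2=-I+\eta\otimes\xi$, $\eta(\xi)=1$ and $g(\phi X,\phi Y)=g(X,Y)-\eta(X)\eta(Y)$. Suppose that it is almost $\alpha$-cosymplectic: $d\eta=0$ and $d\Phi=2\alpha\,\eta\wedge\Phi$, where $\Phi(X,Y)=g(\phi X,Y)$. Put $h=\tfrac12\mathcal L_\xi\phi$, let $\nabla$ be the Levi-Civita connection of $g$ and let $R(X,Y)Z=\nabla_X\nabla_YZ-\nabla_Y\nabla_XZ-\nabla_{[X,Y]}Z$ be its curvature. Let $\kappa,\mu,\nu$ be smooth real functions on $M$ such that $$R(X,Y)\xi=\eta(Y)(\kappa I+\mu h+\nu\phi h)X-\eta(X)(\kappa I+\mu h+\nu\phi h)Y$$ for all smooth vector fields $X,Y$ on $M$ (no condition such as $d\kappa\wedge\eta=0$ is imposed on $\kappa,\mu,\nu$).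 Then, for all smooth vector fields $X,Y$ on $M$, $$\begin{aligned} 0={}&\xi(\kappa)\big(\eta(Y)X-\eta(X)Y\big)+\xi(\mu)\big(\eta(Y)hX-\eta(X)hY\big)+\xi(\nu)\big(\eta(Y)\phi hX-\eta(X)\phi hY\big)\\ &-X(\kappa)\phi^2Y+X(\mu)hY+X(\nu)\phi hY-Y(\mu)hX-Y(\nu)\phi hX+Y(\kappa)\phi^2X\\ &+2(\kappa+\alpha^2)\mu\,g(\phi X,Y)\xi+2\mu\,g(hX,\phi hY)\xi . \end{aligned}$$ -/

import Mathlib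

open scoped Manifold ContDiff Bundle
open Bundle VectorField

noncomputable section

namespace AlmostCosymplectic

section Defs

variable {E : Type*} [NormedAddCommGroup E] [NormedSpace ℝ E]
  {H : Type*} [TopologicalSpace H] {I : ModelWithCorners ℝ E H}
  {M : Type*} [TopologicalSpace M] [ChartedSpace H M]

/-- `X` is a smooth vector field on `M`. -/
def IsSmoothField [IsManifold I ∞ M] (X : (p : M) → TangentSpace I p) : Prop :=
  ContMDiff I I.tangent ∞ (fun p ↦ (⟨p, X p⟩ : TangentBundle I M))

/-- The function `X(f)`, the derivative of `f` along `X`. -/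
def dirDeriv (X : (p : M) → TangentSpace I p) (f : M → ℝ) : M → ℝ :=
  fun p ↦ mvfderiv I f p (X p)

/-- The vector field `∇_X Y`. -/
def covDeriv [IsManifold I ∞ M]
    (nabla : CovariantDerivative I E (fun p : M ↦ TangentSpace I p))
    (X Y : (p : M) → TangentSpace I p) : (p : M) → TangentSpace I p :=
  fun p ↦ nabla Y p (X p)

/-- The curvature `R(X, Y)Z = ∇_X ∇_Y Z - ∇_Y ∇_X Z - ∇_{[X, Y]} Z`. -/
def curvature [IsManifold I ∞ M]
    (nabla : CovariantDerivative I E (fun p : M ↦ TangentSpace I p))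
    (X Y Z : (p : M) → TangentSpace I p) : (p : M) → TangentSpace I p :=
  fun p ↦ covDeriv nabla X (covDeriv nabla Y Z) p - covDeriv nabla Y (covDeriv nabla X Z) p
    - covDeriv nabla (mlieBracket I X Y) Z p

/-- `nabla` is the Levi-Civita connection of the Riemannian metric `g`: it is torsion free, and
`v(g(Y, Z)) = g(∇_v Y, Z) + g(Y, ∇_v Z)` for all tangent vectors `v`. -/
structure IsLeviCivita [FiniteDimensional ℝ E] [CompleteSpace E] [IsManifold I ∞ M]
    (g : ContMDiffRiemannianMetric I ∞ E (fun p : M ↦ TangentSpace I p))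
    (nabla : CovariantDerivative I E (fun p : M ↦ TangentSpace I p)) : Prop where
  torsion_eq_zero : nabla.torsion = 0
  metric_compatible : ∀ (Y Z : (p : M) → TangentSpace I p) (p : M),
    MDifferentiableAt I I.tangent (fun q ↦ (⟨q, Y q⟩ : TangentBundle I M)) p →
    MDifferentiableAt I I.tangent (fun q ↦ (⟨q, Z q⟩ : TangentBundle I M)) p →
    ∀ v : TangentSpace I p,
      mvfderiv I (fun q ↦ g.inner q (Y q) (Z q)) p v =
        g.inner p (nabla Y p v) (Z p) + g.inner p (Y p) (nabla Z p v)

variable (I M) in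
/-- An almost contact metric structure `(φ, ξ, η, g)` on `M`. -/
structure AlmostContactMetric [IsManifold I ∞ M] where
  φ : (p : M) → TangentSpace I p →L[ℝ] TangentSpace I p
  ξ : (p : M) → TangentSpace I p
  η : (p : M) → TangentSpace I p →L[ℝ] ℝ
  g : ContMDiffRiemannianMetric I ∞ E (fun p : M ↦ TangentSpace I p)
  φ_smooth : ContMDiff I (I.prod 𝓘(ℝ, E →L[ℝ] E)) ∞
    (fun p ↦ TotalSpace.mk' (E →L[ℝ] E)
      (E := fun q : M ↦ (TangentSpace I q →L[ℝ] TangentSpace I q)) p (φ p))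
  ξ_smooth : IsSmoothField ξ
  η_smooth : ContMDiff I (I.prod 𝓘(ℝ, E →L[ℝ] ℝ)) ∞
    (fun p ↦ TotalSpace.mk' (E →L[ℝ] ℝ)
      (E := fun q : M ↦ (TangentSpace I q →L[ℝ] Bundle.Trivial M ℝ q)) p (η p))
  φ_sq : ∀ (p : M) (v : TangentSpace I p), φ p (φ p v) = -v + η p v • ξ p
  η_ξ : ∀ p : M, η p (ξ p) = 1
  compatible : ∀ (p : M) (v w : TangentSpace I p),
    g.inner p (φ p v) (φ p w) = g.inner p v w - η p v * η p w

namespace AlmostContactMetric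

variable [IsManifold I ∞ M] (S : AlmostContactMetric I M)

/-- The vector field `φX`. -/
def phi (X : (p : M) → TangentSpace I p) : (p : M) → TangentSpace I p :=
  fun p ↦ S.φ p (X p)

/-- The function `η(X)`. -/
def eta (X : (p : M) → TangentSpace I p) : M → ℝ :=
  fun p ↦ S.η p (X p)

/-- The function `g(X, Y)`. -/
def metric (X Y : (p : M) → TangentSpace I p) : M → ℝ :=
  fun p ↦ S.g.inner p (X p) (Y p)

/-- The fundamental 2-form `Φ(X, Y) = g(φX, Y)`. -/
def fundForm (X Y : (p : M) → TangentSpace I p) : M → ℝ :=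
  S.metric (S.phi X) Y

/-- The vector field `hX`, where `h = (1/2) L_ξ φ`, i.e. `hX = (1/2) ([ξ, φX] - φ[ξ, X])`. -/
def h (X : (p : M) → TangentSpace I p) : (p : M) → TangentSpace I p :=
  fun p ↦ (1 / 2 : ℝ) • (mlieBracket I S.ξ (S.phi X) p - S.phi (mlieBracket I S.ξ X) p)

/-- `dη(X, Y) = X(η(Y)) - Y(η(X)) - η([X, Y])`. -/
def dEta (X Y : (p : M) → TangentSpace I p) : M → ℝ :=
  dirDeriv X (S.eta Y) - dirDeriv Y (S.eta X) - S.eta (mlieBracket I X Y)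

/-- `dΦ(X, Y, Z)`, by the invariant formula for the exterior derivative of a 2-form. -/
def dFundForm (X Y Z : (p : M) → TangentSpace I p) : M → ℝ :=
  dirDeriv X (S.fundForm Y Z) + dirDeriv Y (S.fundForm Z X) + dirDeriv Z (S.fundForm X Y)
    - S.fundForm (mlieBracket I X Y) Z - S.fundForm (mlieBracket I Y Z) X
    - S.fundForm (mlieBracket I Z X) Y

/-- `(η ∧ Φ)(X, Y, Z)`. -/
def etaWedgeFundForm (X Y Z : (p : M) → TangentSpace I p) : M → ℝ :=
  S.eta X * S.fundForm Y Z + S.eta Y * S.fundForm Z X + S.eta Z * S.fundForm X Y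

/-- The structure is almost `α`-cosymplectic: `dη = 0` and `dΦ = 2α η ∧ Φ`. -/
structure IsAlmostCosymplectic (α : ℝ) : Prop where
  dEta_eq_zero : ∀ X Y : (p : M) → TangentSpace I p, IsSmoothField X → IsSmoothField Y →
    S.dEta X Y = 0
  dFundForm_eq : ∀ X Y Z : (p : M) → TangentSpace I p,
    IsSmoothField X → IsSmoothField Y → IsSmoothField Z →
    S.dFundForm X Y Z = (2 * α) • S.etaWedgeFundForm X Y Z

/-- The `(κ, μ, ν)`-nullity condition
`R(X, Y)ξ = η(Y)(κI + μh + νφh)X - η(X)(κI + μh + νφh)Y`. -/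
def IsNullity (nabla : CovariantDerivative I E (fun p : M ↦ TangentSpace I p))
    (κ μ ν : M → ℝ) : Prop :=
  ∀ X Y : (p : M) → TangentSpace I p, IsSmoothField X → IsSmoothField Y → ∀ p : M,
    curvature nabla X Y S.ξ p =
      S.eta Y p • (κ p • X p + μ p • S.h X p + ν p • S.phi (S.h X) p)
      - S.eta X p • (κ p • Y p + μ p • S.h Y p + ν p • S.phi (S.h Y) p)

end AlmostContactMetric

end Defs

end AlmostCosymplectic

end

/-!
The identity is tensorial and is checked at one point at a time, but most of the proof is algebra
over the ring of smooth functions. `LeviCivitaCalculus` and `AlmostCosymplecticCalculus` record what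
that algebra needs of the module of smooth vector fields; the manifold enters through
`leviCivitaCalculus` and `AlmostContactMetric.calculus`. The analytic input is that `∇` preserves
smoothness: by the Koszul formula the products `g(∇_X Y, Z)` are smooth, and Cramer's rule for the
Gram matrix of a local frame recovers `∇_X Y` from them.

From `dη = 0` and `dΦ = 2α η ∧ Φ` one obtains `∇_ξ φ = 0` and `∇_X ξ = α (X - η(X) ξ) - B X`, where
the symmetric endomorphism `B = φ h` anticommutes with `φ` and kills `ξ`. The nullity condition then
says two things about `B`: its part `R(X, ξ)ξ` gives `B² = -(κ + α²)` on horizontal fields, those in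
the kernel of `η` (`B_B`), and its part `R(X, Y)ξ = 0` for horizontal `X`, `Y` is the Codazzi
equation for `B` (`covEnd_B_comm`).

The second Bianchi identity applied to `ξ`, in the directions `X`, `Y`, `ξ`, gives the claim for
horizontal `X`, `Y` up to an error term `μ (g((∇_X φ) B Y, Z) - g((∇_Y φ) B X, Z))`
(`bianchi_horizontal`); the curvature terms in which `ξ` has been differentiated vanish by pair
symmetry. To see that the error term vanishes at a point, one distinguishes the sign of
`s = -(κ + α²)` there, which cannot be negative when there are nonzero horizontal vectors, because
`g(BX, BX) = s g(X, X)`.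

* If `s > 0`, then `∇φ` vanishes on horizontal vectors, that is, the leaves of `ker η` are Kähler
  (`ev_covEnd_φ`). Horizontal vectors split into the eigenspaces of `B` for `±√s`, which `φ`
  exchanges. On eigenvectors for the same eigenvalue the covariant derivative of `B² = s` expresses
  `∇B` through `dκ`, and the Codazzi equation together with the derivative of `φ B + B φ = 0` and
  the cyclic identity for `∇φ` (from `dΦ`) leaves nothing of `∇φ`. No constancy of `κ` along the
  leaves is needed: the terms with `dκ` cancel.
* If `s = 0`, then `B` vanishes at the point, and so does `dκ`, by differentiating
  `g(BU, BU) = s g(U, U)`; every term of the identity is then zero.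

The passage to arbitrary `X` and `Y` only adds terms along `ξ`, and the two multiples of `ξ` in the
claim cancel, because `h² = (κ + α²) φ²` (`g_h_φ_h`, `defect_eq`).
-/

namespace AlmostCosymplectic

noncomputable section

/-! ### The Levi-Civita calculus, algebraically -/

/-- The algebraic structure carried by the smooth vector fields `𝔛` of a Riemannian manifold as a
module over the ring `R` of smooth functions: the action `D` on functions, the Lie bracket `br`, the
metric `g` and its Levi-Civita connection `nab`. The bracket is a bare function: that it is
biadditive, skew-symmetric and satisfies the Leibniz rule follows from `torsion_free`. -/
structure LeviCivitaCalculus (R 𝔛 : Type*) [CommRing R] [Algebra ℝ R] [AddCommGroup 𝔛]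
    [Module R 𝔛] where
  D : 𝔛 →ₗ[R] Derivation ℝ R R
  br : 𝔛 → 𝔛 → 𝔛
  nab : 𝔛 →ₗ[R] 𝔛 →+ 𝔛
  g : 𝔛 →ₗ[R] 𝔛 →ₗ[R] R
  nab_smul : ∀ X f Y, nab X (f • Y) = f • nab X Y + D X f • Y
  torsion_free : ∀ X Y, nab X Y - nab Y X = br X Y
  jacobi : ∀ X Y Z, br X (br Y Z) = br (br X Y) Z + br Y (br X Z)
  g_symm : ∀ X Y, g X Y = g Y X
  g_def : ∀ X, g X X = 0 → X = 0
  D_g : ∀ X Y Z, D X (g Y Z) = g (nab X Y) Z + g Y (nab X Z)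

namespace LeviCivitaCalculus

variable {R 𝔛 : Type*} [CommRing R] [Algebra ℝ R] [AddCommGroup 𝔛] [Module R 𝔛]
  (S : LeviCivitaCalculus R 𝔛)

lemma two_mul_half : (2 : R) * algebraMap ℝ R (1 / 2) = 1 := by
  rw [← map_ofNat (algebraMap ℝ R) 2, ← map_mul]; norm_num

/-- `2` acts injectively on every module over a real algebra. -/
lemma eq_zero_of_two_smul {V : Type*} [AddCommGroup V] [Module R V] {x : V}
    (h : (2 : R) • x = 0) : x = 0 := by
  have := congrArg (fun y ↦ algebraMap ℝ R (1 / 2) • y) h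
  simpa only [smul_smul, mul_comm _ (2 : R), two_mul_half, one_smul, smul_zero] using this

lemma eq_of_g {X Y : 𝔛} (h : ∀ Z, S.g X Z = S.g Y Z) : X = Y := by
  rw [← sub_eq_zero]
  apply S.g_def
  simp [h]

lemma br_smul (X Y : 𝔛) (f : R) : S.br X (f • Y) = f • S.br X Y + S.D X f • Y := by
  rw [← S.torsion_free, ← S.torsion_free, S.nab_smul, map_smul, AddMonoidHom.smul_apply]
  module

lemma br_add (X Y Z : 𝔛) : S.br X (Y + Z) = S.br X Y + S.br X Z := by
  simp only [← S.torsion_free, map_add, AddMonoidHom.add_apply]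
  abel

/-- If some vector field is nowhere zero, the bracket acts on functions as the commutator: compare
the two sides of the Jacobi identity for `X`, `Y` and `f • W`. -/
lemma D_br {W : 𝔛} {θ : 𝔛 →ₗ[R] R} (hW : θ W = 1) (X Y : 𝔛) (f : R) :
    S.D (S.br X Y) f = S.D X (S.D Y f) - S.D Y (S.D X f) := by
  have h := S.jacobi X Y (f • W)
  simp only [br_smul, br_add, S.jacobi X Y W] at h
  have h2 := congrArg θ h
  simp only [map_add, map_smul, smul_eq_mul, hW] at h2
  linear_combination -h2

/-- The curvature `R(X, Y)Z`. -/
def curv (X Y Z : 𝔛) : 𝔛 :=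
  S.nab X (S.nab Y Z) - S.nab Y (S.nab X Z) - S.nab (S.br X Y) Z

lemma br_swap (X Y : 𝔛) : S.br X Y = -S.br Y X := by
  rw [← S.torsion_free, ← S.torsion_free]; abel

lemma curv_swap (X Y Z : 𝔛) : S.curv X Y Z = -S.curv Y X Z := by
  simp only [curv, S.br_swap X Y, map_neg, AddMonoidHom.neg_apply]
  abel

/-- The first Bianchi identity. -/
lemma curv_cyclic (X Y Z : 𝔛) : S.curv X Y Z + S.curv Y Z X + S.curv Z X Y = 0 := by
  have h := S.jacobi X Y Z
  rw [S.br_swap (S.br X Y) Z, S.br_swap X Z] at h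
  simp only [← S.torsion_free, map_sub, map_neg, AddMonoidHom.sub_apply,
    AddMonoidHom.neg_apply] at h
  simp only [curv, ← S.torsion_free, map_sub, AddMonoidHom.sub_apply]
  linear_combination (norm := module) h

lemma g_curv_skew {W : 𝔛} {θ : 𝔛 →ₗ[R] R} (hW : θ W = 1) (X Y Z V : 𝔛) :
    S.g (S.curv X Y Z) V = -S.g (S.curv X Y V) Z := by
  have h := S.D_br hW X Y (S.g Z V)
  simp only [S.D_g, map_add] at h
  simp only [curv, map_sub, LinearMap.sub_apply]
  have e1 := S.g_symm Z (S.nab X (S.nab Y V))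
  have e2 := S.g_symm Z (S.nab Y (S.nab X V))
  have e3 := S.g_symm Z (S.nab (S.br X Y) V)
  linear_combination -h - e1 + e2 + e3

/-- The pair symmetry of the curvature tensor. -/
lemma g_curv_pair {W : 𝔛} {θ : 𝔛 →ₗ[R] R} (hW : θ W = 1) (X Y Z V : 𝔛) :
    S.g (S.curv X Y Z) V = S.g (S.curv Z V X) Y := by
  have cyc (A B C E : 𝔛) : S.g (S.curv A B C) E + S.g (S.curv B C A) E
      + S.g (S.curv C A B) E = 0 := by
    simpa using congrArg (fun T ↦ S.g T E) (S.curv_cyclic A B C)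
  have sk := S.g_curv_skew hW
  have sw (A B C E : 𝔛) : S.g (S.curv A B C) E = -S.g (S.curv B A C) E := by
    rw [S.curv_swap A B C]; simp
  rw [← sub_eq_zero]
  apply eq_zero_of_two_smul (R := R)
  rw [smul_eq_mul]
  linear_combination cyc X Y Z V + cyc Y Z V X - cyc Z V X Y - cyc V X Y Z - sk Y Z V X
    - sk Z V Y X + sw X Z V Y - sk Z X V Y + sk V X Y Z + sk X Y V Z + sw Y V X Z - sk V Y X Z

/-- The identity `d^∇ (R V) = R ∧ ∇V`, the second Bianchi identity applied to the section `V`. -/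
lemma bianchi (X Y Z V : 𝔛) :
    S.nab X (S.curv Y Z V) + S.nab Y (S.curv Z X V) + S.nab Z (S.curv X Y V)
      - S.curv (S.br X Y) Z V - S.curv (S.br Y Z) X V - S.curv (S.br Z X) Y V
    = S.curv Y Z (S.nab X V) + S.curv Z X (S.nab Y V) + S.curv X Y (S.nab Z V) := by
  have h := S.jacobi X Y Z
  rw [S.br_swap X (S.br Y Z), S.br_swap Y (S.br X Z), S.br_swap X Z] at h
  have h' : S.nab (S.br (S.br X Y) Z) V + S.nab (S.br (S.br Y Z) X) V
      + S.nab (S.br (S.br Z X) Y) V = 0 := by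
    rw [← AddMonoidHom.add_apply, ← AddMonoidHom.add_apply, ← map_add, ← map_add]
    have e : S.br (-S.br Z X) Y = -S.br (S.br Z X) Y := by
      simp only [← S.torsion_free, map_neg, map_sub, AddMonoidHom.neg_apply,
        AddMonoidHom.sub_apply]
      abel
    rw [e] at h
    have : S.br (S.br X Y) Z + S.br (S.br Y Z) X + S.br (S.br Z X) Y = 0 := by
      linear_combination (norm := module) -h
    rw [this]; simp
  simp only [curv, map_sub]
  linear_combination (norm := module) h'

/-- The covariant derivative `(X, Y) ↦ (∇_X L) Y` of an endomorphism field `L`. -/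
def covEnd (L : 𝔛 →ₗ[R] 𝔛) : 𝔛 →ₗ[R] 𝔛 →ₗ[R] 𝔛 :=
  LinearMap.mk₂ R (fun X Y ↦ S.nab X (L Y) - L (S.nab X Y))
    (fun X X' Y ↦ by simp only [map_add, AddMonoidHom.add_apply]; abel)
    (fun f X Y ↦ by simp only [map_smul, AddMonoidHom.smul_apply]; module)
    (fun X Y Y' ↦ by simp only [map_add]; abel)
    (fun f X Y ↦ by simp only [map_smul, S.nab_smul, map_add]; module)

lemma covEnd_apply (L : 𝔛 →ₗ[R] 𝔛) (X Y : 𝔛) :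
    S.covEnd L X Y = S.nab X (L Y) - L (S.nab X Y) := rfl

end LeviCivitaCalculus

/-! ### Almost cosymplectic structures, algebraically -/

/-- An almost `a`-cosymplectic structure `(φ, ξ, η, g)` on top of a Levi-Civita calculus. The
constant `a` is a ring element on which all vector fields vanish. -/
structure AlmostCosymplecticCalculus (R 𝔛 : Type*) [CommRing R] [Algebra ℝ R] [AddCommGroup 𝔛]
    [Module R 𝔛] extends LeviCivitaCalculus R 𝔛 where
  φ : 𝔛 →ₗ[R] 𝔛
  ξ : 𝔛
  η : 𝔛 →ₗ[R] R
  a : R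
  D_a : ∀ X, D X a = 0
  φ_sq : ∀ X, φ (φ X) = -X + η X • ξ
  η_ξ : η ξ = 1
  compatible : ∀ X Y, g (φ X) (φ Y) = g X Y - η X * η Y
  dη : ∀ X Y, D X (η Y) - D Y (η X) - η (br X Y) = 0
  dΦ : ∀ X Y Z, D X (g (φ Y) Z) + D Y (g (φ Z) X) + D Z (g (φ X) Y)
      - g (φ (br X Y)) Z - g (φ (br Y Z)) X - g (φ (br Z X)) Y
    = 2 * a * (η X * g (φ Y) Z + η Y * g (φ Z) X + η Z * g (φ X) Y)

namespace AlmostCosymplecticCalculus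

open LeviCivitaCalculus

variable {R 𝔛 : Type*} [CommRing R] [Algebra ℝ R] [AddCommGroup 𝔛] [Module R 𝔛]
  (S : AlmostCosymplecticCalculus R 𝔛)

lemma φ_ξ : S.φ S.ξ = 0 := by
  have h0 : S.φ (S.φ S.ξ) = 0 := by rw [S.φ_sq, S.η_ξ]; module
  -- `φ ξ` is a multiple of `ξ` by a function whose square vanishes
  have h1 : S.φ S.ξ = S.η (S.φ S.ξ) • S.ξ := by
    have := S.φ_sq (S.φ S.ξ)
    rw [h0, map_zero] at this
    linear_combination (norm := module) this
  have h2 : S.η (S.φ S.ξ) * S.η (S.φ S.ξ) = 0 := by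
    have := congrArg (fun X ↦ S.η (S.φ X)) h1
    simpa [h0] using this.symm
  apply S.g_def
  have h3 : S.g (S.η (S.φ S.ξ) • S.ξ) (S.η (S.φ S.ξ) • S.ξ) = 0 := by
    simp only [map_smul, LinearMap.smul_apply, smul_eq_mul]
    linear_combination S.g S.ξ S.ξ * h2
  rwa [← h1] at h3

lemma η_eq (X : 𝔛) : S.η X = S.g X S.ξ := by
  have := S.compatible X S.ξ
  rw [S.φ_ξ, map_zero, S.η_ξ] at this
  linear_combination this

lemma η_φ (X : 𝔛) : S.η (S.φ X) = 0 := by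
  have h := congrArg S.η (S.φ_sq (S.φ X))
  rw [S.φ_sq X] at h
  simp only [map_add, map_neg, map_smul, S.φ_ξ, smul_zero, add_zero, smul_eq_mul, S.η_ξ] at h
  linear_combination -h

lemma g_φ (X Y : 𝔛) : S.g (S.φ X) Y = -S.g X (S.φ Y) := by
  have h := S.compatible X (S.φ Y)
  rw [S.φ_sq, S.η_φ] at h
  simp only [map_add, map_neg, map_smul, ← S.η_eq, S.η_φ, smul_eq_mul] at h
  linear_combination -h

/-- The endomorphism `A X = ∇_X ξ`. -/
def A : 𝔛 →ₗ[R] 𝔛 where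
  toFun X := S.nab X S.ξ
  map_add' X Y := by simp
  map_smul' f X := by simp

lemma nab_ξ (X : 𝔛) : S.nab X S.ξ = S.A X := rfl

lemma D_η (X Y : 𝔛) : S.D X (S.η Y) = S.η (S.nab X Y) + S.g Y (S.A X) := by
  rw [S.η_eq, S.η_eq, S.D_g, nab_ξ]

lemma A_symm (X Y : 𝔛) : S.g (S.A X) Y = S.g X (S.A Y) := by
  have h := S.dη X Y
  rw [S.D_η, S.D_η, ← S.torsion_free, map_sub, S.g_symm Y] at h
  linear_combination h

lemma η_A (X : 𝔛) : S.η (S.A X) = 0 := by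
  have h := S.D_η X S.ξ
  rw [S.η_ξ, Derivation.map_one_eq_zero, S.nab_ξ, S.g_symm, ← S.η_eq] at h
  apply eq_zero_of_two_smul (R := R)
  rw [smul_eq_mul]
  linear_combination -h

lemma A_ξ : S.A S.ξ = 0 := by
  apply S.eq_of_g
  intro Z
  rw [S.A_symm, S.g_symm, ← S.η_eq, S.η_A, map_zero, LinearMap.zero_apply]

/-- The `ξ`-component of `dΦ = 2a η ∧ Φ`: it computes the Lie derivative of `Φ` along `ξ`. -/
lemma covEnd_φ_ξ_add (X : 𝔛) :
    S.covEnd S.φ S.ξ X + S.φ (S.A X) + S.A (S.φ X) = (2 * S.a) • S.φ X := by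
  apply S.eq_of_g
  intro Z
  have h := S.dΦ S.ξ X Z
  simp only [S.g_φ _ S.ξ, S.φ_ξ, map_zero, LinearMap.zero_apply, S.η_ξ, neg_zero,
    ← S.torsion_free, map_sub, LinearMap.sub_apply, S.nab_ξ, S.D_g] at h
  simp only [S.covEnd_apply, map_add, map_sub, map_smul, LinearMap.add_apply, LinearMap.sub_apply,
    LinearMap.smul_apply, smul_eq_mul]
  have e1 := S.g_φ (S.A Z) X
  have e2 := S.A_symm (S.φ X) Z
  have e3 := S.g_φ (S.nab S.ξ Z) X
  have e4 := S.g_symm (S.nab S.ξ Z) (S.φ X)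
  have e5 := S.g_symm (S.A Z) (S.φ X)
  linear_combination h + e2 + e1 - e3 + e4 - e5

lemma A_φ_sq (X : 𝔛) : S.A (S.φ (S.φ X)) = -S.A X := by
  rw [S.φ_sq, map_add, map_smul, S.A_ξ, map_neg]; module

lemma φ_sq_A (X : 𝔛) : S.φ (S.φ (S.A X)) = -S.A X := by
  rw [S.φ_sq, S.η_A]; module

/-- `∇_ξ φ = 0`: the endomorphism `∇_ξ φ` both commutes and anticommutes with `φ`. -/
lemma nab_ξ_φ (X : 𝔛) : S.nab S.ξ (S.φ X) = S.φ (S.nab S.ξ X) := by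
  set N := S.covEnd S.φ S.ξ with hN
  have anti (Y : 𝔛) : N (S.φ Y) + S.φ (N Y) = 0 := by
    simp only [hN, S.covEnd_apply, map_sub, S.φ_sq, map_add, map_neg, S.nab_smul, S.nab_ξ, S.A_ξ,
      map_zero, S.D_η]
    module
  have comm (Y : 𝔛) : N (S.φ Y) - S.φ (N Y) = 0 := by
    have h1 := S.covEnd_φ_ξ_add (S.φ Y)
    have h2 := congrArg S.φ (S.covEnd_φ_ξ_add Y)
    simp only [map_add, map_smul, S.φ_sq_A, S.A_φ_sq] at h1 h2
    rw [← hN] at h1 h2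
    linear_combination (norm := module) h1 - h2
  have h0 (Y : 𝔛) : N (S.φ Y) = 0 := by
    apply eq_zero_of_two_smul (R := R)
    linear_combination (norm := module) anti Y + comm Y
  have h1 : N X = 0 := by
    have h2 := h0 (S.φ X)
    have h3 : N S.ξ = 0 := by simp [hN, S.covEnd_apply, S.φ_ξ, S.nab_ξ, S.A_ξ]
    rw [S.φ_sq, map_add, map_neg, map_smul, h3] at h2
    linear_combination (norm := module) -h2
  rw [hN, S.covEnd_apply] at h1
  exact sub_eq_zero.1 h1

lemma φ_A_add (X : 𝔛) : S.φ (S.A X) + S.A (S.φ X) = (2 * S.a) • S.φ X := by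
  have h := S.covEnd_φ_ξ_add X
  rw [S.covEnd_apply, S.nab_ξ_φ, sub_self, zero_add] at h
  exact h

/-- The tensor `h = ½ L_ξ φ`. -/
def h (X : 𝔛) : 𝔛 :=
  algebraMap ℝ R (1 / 2) • (S.br S.ξ (S.φ X) - S.φ (S.br S.ξ X))

/-- The endomorphism `B X = a (X - η(X) ξ) - ∇_X ξ`, which equals `φ h`. -/
def B : 𝔛 →ₗ[R] 𝔛 := S.a • (LinearMap.id - S.η.smulRight S.ξ) - S.A

lemma B_apply (X : 𝔛) : S.B X = S.a • (X - S.η X • S.ξ) - S.A X := rfl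

lemma h_eq (X : 𝔛) : S.h X = -S.φ (S.B X) := by
  have e : S.br S.ξ (S.φ X) - S.φ (S.br S.ξ X) = (2 : R) • -S.φ (S.B X) := by
    simp only [← S.torsion_free, S.nab_ξ_φ, S.B_apply, map_sub, map_smul, S.φ_ξ, S.nab_ξ]
    linear_combination (norm := module) -S.φ_A_add X
  rw [h, e, smul_smul, mul_comm, two_mul_half, one_smul]

lemma B_ξ : S.B S.ξ = 0 := by
  simp [S.B_apply, S.η_ξ, S.A_ξ]

lemma η_B (X : 𝔛) : S.η (S.B X) = 0 := by
  simp [S.B_apply, S.η_ξ, S.η_A]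

lemma B_φ (X : 𝔛) : S.B (S.φ X) = -S.φ (S.B X) := by
  simp only [S.B_apply, S.η_φ, map_sub, map_smul, S.φ_ξ]
  linear_combination (norm := module) -S.φ_A_add X

lemma B_symm (X Y : 𝔛) : S.g (S.B X) Y = S.g X (S.B Y) := by
  simp only [S.B_apply, map_sub, map_smul, LinearMap.sub_apply, LinearMap.smul_apply, smul_eq_mul,
    S.A_symm X Y, ← S.η_eq, S.g_symm S.ξ]
  ring

lemma φ_h (X : 𝔛) : S.φ (S.h X) = S.B X := by
  rw [S.h_eq, map_neg, S.φ_sq, S.η_B]; module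

lemma h_φ (X : 𝔛) : S.h (S.φ X) = -S.φ (S.h X) := by
  rw [S.h_eq, S.h_eq, S.B_φ, map_neg]

lemma φ_φ {X : 𝔛} (hX : S.η X = 0) : S.φ (S.φ X) = -X := by
  rw [S.φ_sq, hX]; module

lemma g_φ_φ {X : 𝔛} (hX : S.η X = 0) (Y : 𝔛) : S.g (S.φ X) (S.φ Y) = S.g X Y := by
  rw [S.compatible, hX]; ring

lemma A_eq {X : 𝔛} (hX : S.η X = 0) : S.A X = S.a • X - S.B X := by
  rw [S.B_apply, hX]; module

lemma η_br {X Y : 𝔛} (hX : S.η X = 0) (hY : S.η Y = 0) : S.η (S.br X Y) = 0 := by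
  have := S.dη X Y
  rw [hX, hY, map_zero, map_zero] at this
  linear_combination -this

lemma η_br_ξ {X : 𝔛} (hX : S.η X = 0) : S.η (S.br X S.ξ) = 0 := by
  have := S.dη X S.ξ
  rw [hX, S.η_ξ, map_zero, Derivation.map_one_eq_zero] at this
  linear_combination -this

/-! ### The nullity condition -/

/-- The operator `T = κ I + μ h + ν φ h` of the nullity condition. -/
def T (κ μ ν : R) (X : 𝔛) : 𝔛 := κ • X + μ • S.h X + ν • S.φ (S.h X)

lemma T_eq (κ μ ν : R) (X : 𝔛) : S.T κ μ ν X = κ • X + μ • S.h X + ν • S.B X := by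
  rw [T, S.φ_h]

/-- The `(κ, μ, ν)`-nullity condition. -/
def IsNullity (κ μ ν : R) : Prop :=
  ∀ X Y, S.curv X Y S.ξ = S.η Y • S.T κ μ ν X - S.η X • S.T κ μ ν Y


/-! ### Identities for `∇φ` and `∇B` -/

section Identities

variable (S : AlmostCosymplecticCalculus R 𝔛)

/-- The covariant derivative of the skew-symmetry of `φ`. -/
lemma g_covEnd_φ_skew (X Y Z : 𝔛) :
    S.g (S.covEnd S.φ X Y) Z = -S.g (S.covEnd S.φ X Z) Y := by
  have h := congrArg (S.D X) (S.g_φ Y Z)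
  simp only [S.D_g, map_neg] at h
  simp only [S.covEnd_apply, map_sub, LinearMap.sub_apply]
  linear_combination h - S.g_φ Y (S.nab X Z) - S.g_φ (S.nab X Y) Z - S.g_symm Y (S.nab X (S.φ Z))
    + S.g_symm Y (S.φ (S.nab X Z))

/-- The covariant derivative of `φ² = -1`, on horizontal fields. -/
lemma g_covEnd_φ_φ (X : 𝔛) {Y Z : 𝔛} (hY : S.η Y = 0) (hZ : S.η Z = 0) :
    S.g (S.covEnd S.φ X (S.φ Y)) Z = S.g (S.covEnd S.φ X Y) (S.φ Z) := by
  have h1 := S.compatible (S.nab X Y) Z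
  rw [hZ] at h1
  simp only [S.covEnd_apply, map_sub, LinearMap.sub_apply, S.φ_φ hY, map_neg,
    LinearMap.neg_apply]
  linear_combination h1 - S.g_φ (S.nab X (S.φ Y)) Z

/-- `dΦ = 2a η ∧ Φ` vanishes on horizontal fields: the leaves are almost Kähler. -/
lemma g_covEnd_φ_cyclic {X Y Z : 𝔛} (hX : S.η X = 0) (hY : S.η Y = 0) (hZ : S.η Z = 0) :
    S.g (S.covEnd S.φ X Y) Z + S.g (S.covEnd S.φ Y Z) X + S.g (S.covEnd S.φ Z X) Y = 0 := by
  have h := S.dΦ X Y Z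
  simp only [hX, hY, hZ, ← S.torsion_free, map_sub, LinearMap.sub_apply, S.D_g] at h
  simp only [S.covEnd_apply, map_sub, LinearMap.sub_apply]
  have e (U V W : 𝔛) : S.g (S.φ (S.nab U V)) W = -S.g (S.φ W) (S.nab U V) := by
    rw [S.g_φ, S.g_symm]
  linear_combination h - e Y X Z - e Z Y X - e X Z Y

/-- The covariant derivative of the symmetry of `B`. -/
lemma g_covEnd_B_symm (X Y Z : 𝔛) :
    S.g (S.covEnd S.B X Y) Z = S.g (S.covEnd S.B X Z) Y := by
  have h := congrArg (S.D X) (S.B_symm Y Z)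
  simp only [S.D_g] at h
  simp only [S.covEnd_apply, map_sub, LinearMap.sub_apply]
  linear_combination h - S.B_symm Y (S.nab X Z) - S.B_symm (S.nab X Y) Z
    + S.g_symm Y (S.nab X (S.B Z)) + S.g_symm (S.B (S.nab X Z)) Y

/-- The covariant derivative of `φB + Bφ = 0`. -/
lemma g_covEnd_φ_B (X Y Z : 𝔛) :
    S.g (S.covEnd S.φ X (S.B Y)) Z + S.g (S.covEnd S.φ X Y) (S.B Z)
      = S.g (S.covEnd S.B X Y) (S.φ Z) - S.g (S.covEnd S.B X (S.φ Y)) Z := by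
  simp only [S.covEnd_apply, map_sub, LinearMap.sub_apply, S.B_φ, map_neg, LinearMap.neg_apply]
  have h1 := S.B_symm (S.nab X (S.φ Y)) Z
  have h2 := S.g_φ (S.nab X (S.B Y)) Z
  have h3 := S.g_φ (S.B (S.nab X Y)) Z
  have h4 := S.B_symm (S.φ (S.nab X Y)) Z
  rw [S.B_φ, map_neg, LinearMap.neg_apply] at h4
  linear_combination -h1 - h2 + h3 + h4

end Identities

section Nullity

variable {S : AlmostCosymplecticCalculus R 𝔛} {κ μ ν : R} (hR : S.IsNullity κ μ ν)
include hR

/-- `B² = -(κ + a²)` on horizontal fields: in `R(X, ξ)ξ = TX`, the terms `∇_ξ B`, `h` and `B`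
anticommute with `φ`, while the remaining ones commute with it. -/
lemma B_B {X : 𝔛} (hX : S.η X = 0) : S.B (S.B X) = -(κ + S.a ^ 2) • X := by
  have key {Y : 𝔛} (hY : S.η Y = 0) : κ • Y + μ • S.h Y + ν • S.B Y
      = S.nab S.ξ (S.B Y) - S.B (S.nab S.ξ Y) - S.a ^ 2 • Y + (2 * S.a) • S.B Y
        - S.B (S.B Y) := by
    have h := hR Y S.ξ
    rw [hY, S.η_ξ, T, S.φ_h] at h
    simp only [curv, S.nab_ξ, S.A_ξ, map_zero] at h
    rw [S.A_eq (S.η_br_ξ hY), ← S.torsion_free, S.nab_ξ, S.A_eq hY] at h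
    simp only [map_sub, map_smul, S.nab_smul, S.D_a] at h
    linear_combination (norm := module) -h
  have h1 := congrArg S.φ (key hX)
  have h2 := key (S.η_φ X)
  simp only [map_add, map_sub, map_smul, S.h_φ, S.B_φ, map_neg, S.nab_ξ_φ, neg_neg] at h1 h2
  have h3 : S.φ (S.B (S.B X)) = -(κ + S.a ^ 2) • S.φ X := by
    rw [← sub_eq_zero]
    apply eq_zero_of_two_smul (R := R)
    linear_combination (norm := module) h1 + h2
  have h4 := congrArg S.φ h3
  rw [S.φ_φ (S.η_B _), map_smul, S.φ_φ hX] at h4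
  linear_combination (norm := module) -h4

/-- `R(X, Y)ξ = 0` for horizontal `X` and `Y`: the Codazzi equation for `B`. -/
lemma covEnd_B_comm {X Y : 𝔛} (hX : S.η X = 0) (hY : S.η Y = 0) :
    S.covEnd S.B X Y = S.covEnd S.B Y X := by
  have h := hR X Y
  rw [hX, hY] at h
  simp only [curv, S.nab_ξ] at h
  rw [S.A_eq (S.η_br hX hY), ← S.torsion_free, S.A_eq hX, S.A_eq hY] at h
  simp only [map_sub, S.nab_smul, S.D_a] at h
  simp only [S.covEnd_apply]
  linear_combination (norm := module) -h

/-- The covariant derivative of `B² = -(κ + a²)`. -/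
lemma g_covEnd_B_B (X : 𝔛) {Y Z : 𝔛} (hY : S.η Y = 0) (hZ : S.η Z = 0) :
    S.g (S.covEnd S.B X (S.B Y)) Z + S.g (S.covEnd S.B X Y) (S.B Z)
      = -S.D X κ * S.g Y Z := by
  have h1 := S.B_symm (S.nab X (S.B Y)) Z
  have h2 := S.B_symm (S.nab X Y) (S.B Z)
  rw [B_B hR hZ] at h2
  simp only [S.covEnd_apply, map_sub, LinearMap.sub_apply, B_B hR hY, S.nab_smul, map_neg, map_add,
    Derivation.leibniz_pow, S.D_a, map_smul, LinearMap.add_apply, LinearMap.smul_apply,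
    smul_eq_mul] at h2 ⊢
  linear_combination -h1 - h2

/-- The second Bianchi identity for `ξ` and `X`, `Y`, `ξ`, paired with a horizontal field; the
curvature terms on its right-hand side vanish by pair symmetry. -/
lemma bianchi_horizontal {X Y Z : 𝔛} (hX : S.η X = 0) (hY : S.η Y = 0) (hZ : S.η Z = 0) :
    S.g (S.D X κ • Y + S.D X μ • S.h Y + S.D X ν • S.B Y
        - S.D Y κ • X - S.D Y μ • S.h X - S.D Y ν • S.B X) Z
      = μ * (S.g (S.covEnd S.φ X (S.B Y)) Z - S.g (S.covEnd S.φ Y (S.B X)) Z) := by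
  have h := S.bianchi X Y S.ξ S.ξ
  have hXξ : S.η (S.br S.ξ X) = 0 := by rw [S.br_swap, map_neg, S.η_br_ξ hX, neg_zero]
  simp only [hR _ _, hX, hY, S.η_br hX hY, S.η_br_ξ hY, hXξ, S.η_ξ, S.nab_ξ, S.A_ξ] at h
  have hz (U : 𝔛) {V : 𝔛} (hV : S.η V = 0) : S.g (S.curv V S.ξ (S.A U)) Z = 0 := by
    rw [S.g_curv_pair S.η_ξ, S.g_curv_skew S.η_ξ, hR, hZ, S.η_A]
    simp
  have h2 := congrArg (fun V ↦ S.g V Z) h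
  have hc := congrArg (fun V ↦ S.g V Z) (covEnd_B_comm hR hX hY)
  have hc' := congrArg (fun V ↦ S.g (S.φ V) Z) (covEnd_B_comm hR hX hY)
  have hzX := hz Y hX
  rw [S.curv_swap] at hzX
  have hc0 : S.curv X Y 0 = 0 := by simp [curv]
  simp only [S.T_eq, ← S.torsion_free, S.h_eq, S.covEnd_apply, map_add, map_sub, map_neg,
    map_smul, S.nab_smul, LinearMap.add_apply, LinearMap.sub_apply, LinearMap.neg_apply,
    LinearMap.smul_apply, smul_eq_mul, hz X hY, hc0, smul_neg, map_zero,
    LinearMap.zero_apply, zero_smul, one_smul, sub_zero, zero_sub] at h2 hc hc' hzX ⊢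
  linear_combination h2 - ν * hc + μ * hc' - hzX

end Nullity


/-! ### Evaluation at a point: the leaves are Kähler where `B ≠ 0` -/

section Pointwise

/-- The horizontal field `X` is, at the point `ev`, an eigenvector of `B` for the eigenvalue `k`:
`B X - k X` is a multiple of some field by a function vanishing at that point. -/
def IsEigen (S : AlmostCosymplecticCalculus R 𝔛) (ev : R →ₐ[ℝ] ℝ) (k : ℝ) (X : 𝔛) : Prop :=
  S.η X = 0 ∧ ∃ r X', ev r = 0 ∧ S.B X = algebraMap ℝ R k • X + r • X'

variable {S : AlmostCosymplecticCalculus R 𝔛} {ev : R →ₐ[ℝ] ℝ} {k : ℝ}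

lemma IsEigen.ev_apply {X : 𝔛} (hX : S.IsEigen ev k X) (θ : 𝔛 →ₗ[R] R) :
    ev (θ (S.B X)) = k * ev (θ X) := by
  obtain ⟨-, r, X', hr, h⟩ := hX
  rw [h]
  simp [hr]

lemma IsEigen.φ {X : 𝔛} (hX : S.IsEigen ev k X) : S.IsEigen ev (-k) (S.φ X) := by
  obtain ⟨-, r, X', hr, h⟩ := hX
  refine ⟨S.η_φ X, r, -S.φ X', hr, ?_⟩
  rw [S.B_φ, h]
  simp only [map_add, map_smul, map_neg]
  module

/-- A field whose length vanishes at a point vanishes there, by Cauchy–Schwarz. -/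
lemma ev_g_eq_zero (hpos : ∀ X, 0 ≤ ev (S.g X X)) {X : 𝔛}
    (hX : ev (S.g X X) = 0) (W : 𝔛) : ev (S.g X W) = 0 := by
  by_contra h
  -- `t ↦ g(tX + W, tX + W)` is affine and nonnegative, hence constant
  have key (t : ℝ) : 0 ≤ 2 * t * ev (S.g X W) + ev (S.g W W) := by
    have := hpos (algebraMap ℝ R t • X + W)
    simp only [map_add, map_smul, LinearMap.add_apply, LinearMap.smul_apply, smul_eq_mul, map_mul,
      hX, S.g_symm W X, AlgHom.commutes, Algebra.algebraMap_self, RingHom.id_apply] at this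
    linarith
  have h1 := key (-(ev (S.g W W) + 1) / (2 * ev (S.g X W)))
  have h2 : 2 * (-(ev (S.g W W) + 1) / (2 * ev (S.g X W))) * ev (S.g X W)
      = -(ev (S.g W W) + 1) := by field_simp
  linarith

variable {κ μ ν : R} (hR : S.IsNullity κ μ ν)
include hR

/-- On an eigenspace of `B`, the derivative of `B² = -(κ + a²)` determines `∇B`. -/
lemma ev_covEnd_B (X : 𝔛) {Y Z : 𝔛} (hY : S.IsEigen ev k Y) (hZ : S.IsEigen ev k Z) :
    2 * k * ev (S.g (S.covEnd S.B X Y) Z) = -ev (S.D X κ) * ev (S.g Y Z) := by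
  have h := congrArg ev (g_covEnd_B_B hR X hY.1 hZ.1)
  have h1 := hY.ev_apply ((S.g.flip Z) ∘ₗ (S.covEnd S.B X))
  have h2 := hZ.ev_apply (S.g (S.covEnd S.B X Y))
  simp only [LinearMap.comp_apply, LinearMap.flip_apply] at h1
  simp only [map_add, map_mul, map_neg, h1, h2] at h
  linear_combination h

/-- The differential of `κ` along an eigenspace of `B`: total symmetry of `∇B` makes
`X(κ) g(Y, Z)` symmetric in `X` and `Y`. -/
lemma ev_D_mul_g {X Y Z : 𝔛} (hX : S.IsEigen ev k X) (hY : S.IsEigen ev k Y)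
    (hZ : S.IsEigen ev k Z) :
    ev (S.D X κ) * ev (S.g Y Z) = ev (S.D Y κ) * ev (S.g X Z) := by
  have h1 := ev_covEnd_B hR X hY hZ
  have h2 := ev_covEnd_B hR Y hX hZ
  rw [covEnd_B_comm hR hX.1 hY.1] at h1
  linear_combination h1 - h2

/-- For `Y` and `Z` in the same eigenspace of `B`, the derivative of `φB + Bφ = 0` expresses
`2k g((∇_X φ) Y, Z)` by values of `∇B`, after Codazzi on eigenvectors for a common eigenvalue. These
are determined by `dκ`, and they cancel by the symmetry `ev_D_mul_g`. -/
lemma ev_covEnd_φ_eigen (hk : k ≠ 0) {X Y Z : 𝔛} (hX : S.IsEigen ev k X ∨ S.IsEigen ev (-k) X)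
    (hY : S.IsEigen ev k Y) (hZ : S.IsEigen ev k Z) : ev (S.g (S.covEnd S.φ X Y) Z) = 0 := by
  have h := congrArg ev (S.g_covEnd_φ_B X Y Z)
  have h1 := hY.ev_apply ((S.g.flip Z) ∘ₗ (S.covEnd S.φ X))
  have h2 := hZ.ev_apply (S.g (S.covEnd S.φ X Y))
  simp only [LinearMap.comp_apply, LinearMap.flip_apply] at h1
  simp only [map_add, map_sub, h1, h2] at h
  suffices 4 * k ^ 2 * ev (S.g (S.covEnd S.φ X Y) Z) = 0 by simpa [hk] using this
  rcases hX with hX | hX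
  · have e1 := ev_covEnd_B hR (S.φ Z) hX hY
    have e2 := ev_covEnd_B hR (S.φ Y) hX hZ
    have e3 := ev_D_mul_g hR hZ.φ hY.φ hX.φ
    rw [S.g_φ_φ hY.1, S.g_φ_φ hZ.1, S.g_symm Y, S.g_symm Z] at e3
    rw [S.g_covEnd_B_symm X Y, covEnd_B_comm hR hX.1 hZ.φ.1,
      covEnd_B_comm hR hX.1 hY.φ.1] at h
    linear_combination 2 * k * h + e1 - e2 - e3
  · have e1 := ev_covEnd_B hR Y hX hZ.φ
    have e2 := ev_covEnd_B hR Z hX hY.φ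
    have hX' := hX.φ
    rw [neg_neg] at hX'
    have e3 := ev_D_mul_g hR hY hZ hX'
    rw [S.g_symm Z, S.g_symm Y, S.g_φ, S.g_φ, map_neg, map_neg] at e3
    rw [covEnd_B_comm hR hX.1 hY.1, S.g_covEnd_B_symm X, covEnd_B_comm hR hX.1 hZ.1,
      S.g_covEnd_B_symm Z] at h
    rw [S.g_covEnd_B_symm Z] at h
    linear_combination 2 * k * h - e1 + e2 - e3

/-- On a single eigenspace of `B` the form `g((∇_X φ) Y, φ W)` is symmetric in `X`, `Y` and
skew-symmetric in `Y`, `W`, hence zero. -/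
lemma ev_covEnd_φ_eigen_φ (hk : k ≠ 0) {X Y W : 𝔛} (hX : S.IsEigen ev k X)
    (hY : S.IsEigen ev k Y) (hW : S.IsEigen ev k W) :
    ev (S.g (S.covEnd S.φ X Y) (S.φ W)) = 0 := by
  have sym {X Y W : 𝔛} (hX : S.IsEigen ev k X) (hY : S.IsEigen ev k Y) (hW : S.IsEigen ev k W) :
      ev (S.g (S.covEnd S.φ X Y) (S.φ W)) = ev (S.g (S.covEnd S.φ Y X) (S.φ W)) := by
    have h := congrArg ev (S.g_covEnd_φ_cyclic hX.1 hY.1 hW.φ.1)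
    rw [S.g_covEnd_φ_skew Y (S.φ W) X] at h
    have h0 := ev_covEnd_φ_eigen hR hk (.inr hW.φ) hX hY
    simp only [map_add, map_neg, h0, map_zero] at h
    linear_combination h
  have skew {X Y W : 𝔛} (hY : S.IsEigen ev k Y) (hW : S.IsEigen ev k W) :
      ev (S.g (S.covEnd S.φ X Y) (S.φ W)) = -ev (S.g (S.covEnd S.φ X W) (S.φ Y)) := by
    rw [← S.g_covEnd_φ_φ X hY.1 hW.1, S.g_covEnd_φ_skew, map_neg]
  have e1 := sym hX hY hW
  have e2 := skew (X := Y) hX hW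
  have e3 := sym hY hW hX
  have e4 := skew (X := W) hY hX
  have e5 := sym hW hX hY
  have e6 := skew (X := X) hW hY
  linarith

/-- `∇φ` vanishes on horizontal fields at every point at which `κ + a² < 0`. -/
lemma ev_covEnd_φ (hs : 0 < ev (-(κ + S.a ^ 2))) {X Y Z : 𝔛} (hX : S.η X = 0) (hY : S.η Y = 0)
    (hZ : S.η Z = 0) : ev (S.g (S.covEnd S.φ X Y) Z) = 0 := by
  obtain ⟨k, hk, hk2⟩ : ∃ k : ℝ, k ≠ 0 ∧ ev (-(κ + S.a ^ 2)) = k ^ 2 :=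
    ⟨√(ev (-(κ + S.a ^ 2))), (Real.sqrt_pos.2 hs).ne', (Real.sq_sqrt hs.le).symm⟩
  have split {U : 𝔛} (hU : S.η U = 0) : ∃ P Q, S.IsEigen ev k P ∧ S.IsEigen ev (-k) Q ∧
      algebraMap ℝ R (2 * k) • U = P + Q := by
    refine ⟨algebraMap ℝ R k • U + S.B U, algebraMap ℝ R k • U - S.B U,
      ⟨by simp [hU, S.η_B], -(κ + S.a ^ 2) - algebraMap ℝ R k ^ 2, U, ?_, ?_⟩,
      ⟨by simp [hU, S.η_B], -(-(κ + S.a ^ 2) - algebraMap ℝ R k ^ 2), U, ?_, ?_⟩, ?_⟩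
    · rw [map_sub, hk2]
      simp
    · rw [map_add, map_smul, B_B hR hU]
      module
    · rw [map_neg, map_sub, hk2]
      simp
    · rw [map_sub, map_smul, B_B hR hU, map_neg]
      module
    · rw [map_mul, map_ofNat]
      module
  have hk' : -k ≠ 0 := neg_ne_zero.2 hk
  -- the case of eigenvectors `Y` and `Z`; the two eigenspaces are exchanged by `φ`
  have main {X Y Z : 𝔛} (hX : S.IsEigen ev k X ∨ S.IsEigen ev (-k) X)
      (hY : S.IsEigen ev k Y ∨ S.IsEigen ev (-k) Y)
      (hZ : S.IsEigen ev k Z ∨ S.IsEigen ev (-k) Z) : ev (S.g (S.covEnd S.φ X Y) Z) = 0 := by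
    have mixed {l : ℝ} (hl : l ≠ 0) {X Y Z : 𝔛} (hX : S.IsEigen ev l X) (hY : S.IsEigen ev l Y)
        (hZ : S.IsEigen ev (-l) Z) : ev (S.g (S.covEnd S.φ X Y) Z) = 0 := by
      have hW := hZ.φ
      rw [neg_neg] at hW
      have := ev_covEnd_φ_eigen_φ hR hl hX hY hW
      rwa [S.φ_φ hZ.1, map_neg, map_neg, neg_eq_zero] at this
    rcases hY with hY | hY <;> rcases hZ with hZ | hZ
    · exact ev_covEnd_φ_eigen hR hk hX hY hZ
    · rcases hX with hX | hX
      · exact mixed hk hX hY hZ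
      · rw [S.g_covEnd_φ_skew, map_neg, mixed hk' hX hZ (by rwa [neg_neg]), neg_zero]
    · rcases hX with hX | hX
      · rw [S.g_covEnd_φ_skew, map_neg, mixed hk hX hZ hY, neg_zero]
      · exact mixed hk' hX hY (by rwa [neg_neg])
    · exact ev_covEnd_φ_eigen hR hk' (by rwa [neg_neg, or_comm]) hY hZ
  obtain ⟨P, Q, hP, hQ, hX⟩ := split hX
  obtain ⟨P', Q', hP', hQ', hY⟩ := split hY
  obtain ⟨P'', Q'', hP'', hQ'', hZ⟩ := split hZ
  have h : ev (S.g (S.covEnd S.φ (algebraMap ℝ R (2 * k) • X) (algebraMap ℝ R (2 * k) • Y))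
      (algebraMap ℝ R (2 * k) • Z)) = 0 := by
    rw [hX, hY, hZ]
    simp only [map_add, LinearMap.add_apply, main (.inl hP) (.inl hP') (.inl hP''),
      main (.inl hP) (.inl hP') (.inr hQ''), main (.inl hP) (.inr hQ') (.inl hP''),
      main (.inl hP) (.inr hQ') (.inr hQ''), main (.inr hQ) (.inl hP') (.inl hP''),
      main (.inr hQ) (.inl hP') (.inr hQ''), main (.inr hQ) (.inr hQ') (.inl hP''),
      main (.inr hQ) (.inr hQ') (.inr hQ''), add_zero]
  simpa [hk] using h

end Pointwise

/-! ### The identity for the differentials of `κ`, `μ`, `ν` -/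

section Differentials

variable (S : AlmostCosymplecticCalculus R 𝔛) (κ μ ν : R)

/-- The horizontal part of the main identity, a skew-symmetric bilinear expression in `X` and `Y`
that is meant for horizontal arguments. -/
def horizontalDefect (X Y : 𝔛) : 𝔛 :=
  S.D X κ • Y + S.D X μ • S.h Y + S.D X ν • S.B Y
    - S.D Y κ • X - S.D Y μ • S.h X - S.D Y ν • S.B X

/-- The right-hand side of the main identity. -/
def defect (X Y : 𝔛) : 𝔛 :=
  S.D S.ξ κ • (S.η Y • X - S.η X • Y)
    + S.D S.ξ μ • (S.η Y • S.h X - S.η X • S.h Y)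
    + S.D S.ξ ν • (S.η Y • S.φ (S.h X) - S.η X • S.φ (S.h Y))
    - S.D X κ • S.φ (S.φ Y)
    + S.D X μ • S.h Y
    + S.D X ν • S.φ (S.h Y)
    - S.D Y μ • S.h X
    - S.D Y ν • S.φ (S.h X)
    + S.D Y κ • S.φ (S.φ X)
    + (2 * (κ + S.a ^ 2) * μ * S.g (S.φ X) Y) • S.ξ
    + (2 * μ * S.g (S.h X) (S.φ (S.h Y))) • S.ξ

variable {S κ μ ν} (hR : S.IsNullity κ μ ν)
include hR

/-- The two `ξ`-components of the main identity cancel, because `h² = (κ + a²) φ²`. -/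
lemma g_h_φ_h (X Y : 𝔛) :
    S.g (S.h X) (S.φ (S.h Y)) = -(κ + S.a ^ 2) * S.g (S.φ X) Y := by
  rw [S.φ_h, ← S.B_symm, S.h_eq, ← S.B_φ, B_B hR (S.η_φ X), map_smul, LinearMap.smul_apply,
    smul_eq_mul]

lemma defect_eq (X Y : 𝔛) : S.defect κ μ ν X Y
    = S.horizontalDefect κ μ ν (X - S.η X • S.ξ) (Y - S.η Y • S.ξ) := by
  rw [defect, g_h_φ_h hR]
  simp only [horizontalDefect, S.φ_h]
  simp only [S.h_eq, S.φ_sq, map_sub, map_smul, S.B_ξ,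
    smul_zero, sub_zero, Derivation.sub_apply, Derivation.smul_apply, smul_eq_mul]
  module

/-- The main identity for horizontal fields, at the point `ev`. The cases are `κ + a² < 0`,
`κ + a² = 0`, and the absence of nonzero horizontal vectors. -/
lemma ev_g_horizontalDefect {ev : R →ₐ[ℝ] ℝ} (hpos : ∀ X, 0 ≤ ev (S.g X X)) {X Y Z : 𝔛}
    (hX : S.η X = 0) (hY : S.η Y = 0) (hZ : S.η Z = 0) :
    ev (S.g (S.horizontalDefect κ μ ν X Y) Z) = 0 := by
  have gB {U : 𝔛} (hU : S.η U = 0) (V : 𝔛) :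
      S.g (S.B U) (S.B V) = -(κ + S.a ^ 2) * S.g U V := by
    rw [← S.B_symm, B_B hR hU, map_smul, LinearMap.smul_apply, smul_eq_mul]
  by_cases hs : 0 < ev (-(κ + S.a ^ 2))
  · rw [horizontalDefect, bianchi_horizontal hR hX hY hZ, map_mul, map_sub,
      ev_covEnd_φ hR hs hX (S.η_B Y) hZ, ev_covEnd_φ hR hs hY (S.η_B X) hZ]
    simp
  by_cases hH : ∃ U, S.η U = 0 ∧ ev (S.g U U) ≠ 0
  · -- here `κ + a²` vanishes, so that `B = 0` and `dκ = 0` at the point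
    obtain ⟨U, hU, hU0⟩ := hH
    have hs0 : ev (-(κ + S.a ^ 2)) = 0 := by
      have h1 := hpos (S.B U)
      rw [gB hU, map_mul] at h1
      have h2 := lt_of_le_of_ne (hpos U) hU0.symm
      exact le_antisymm (not_lt.1 hs) (nonneg_of_mul_nonneg_left h1 h2)
    have hB {V : 𝔛} (hV : S.η V = 0) (W : 𝔛) : ev (S.g (S.B V) W) = 0 :=
      ev_g_eq_zero hpos (by rw [gB hV, map_mul, hs0, zero_mul]) W
    have hD (V : 𝔛) : ev (S.D V κ) = 0 := by
      have h := congrArg (fun f ↦ ev (S.D V f)) (gB hU U)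
      simp only [S.D_g, S.g_symm _ (S.B U), map_add, hB hU, Derivation.leibniz, smul_eq_mul,
        map_mul, hs0, map_neg (S.D V), Derivation.leibniz_pow, S.D_a, add_zero,
        map_neg ev, zero_mul, zero_add] at h
      simpa [hU0] using h
    have hh {V : 𝔛} (hV : S.η V = 0) : ev (S.g (S.h V) Z) = 0 := by
      rw [S.h_eq, ← S.B_φ]
      exact hB (S.η_φ V) Z
    simp [horizontalDefect, hD, hB hX, hB hY, hh hX, hh hY]
  · push Not at hH
    refine ev_g_eq_zero hpos (hH _ ?_) Z
    simp [horizontalDefect, hX, hY, S.η_B, S.h_eq, S.η_φ]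

/-- The main identity, at the point `ev`. -/
theorem ev_g_defect {ev : R →ₐ[ℝ] ℝ} (hpos : ∀ X, 0 ≤ ev (S.g X X)) (X Y W : 𝔛) :
    ev (S.g (S.defect κ μ ν X Y) W) = 0 := by
  have hη (V : 𝔛) : S.η (V - S.η V • S.ξ) = 0 := by simp [S.η_ξ]
  have hW : W = (W - S.η W • S.ξ) + S.η W • S.ξ := by abel
  have hξ : S.η (S.horizontalDefect κ μ ν (X - S.η X • S.ξ) (Y - S.η Y • S.ξ)) = 0 := by
    simp [horizontalDefect, S.η_ξ, S.η_B, S.h_eq, S.η_φ]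
  rw [defect_eq hR, hW, map_add, map_smul, ← S.η_eq, hξ, smul_zero, add_zero]
  exact ev_g_horizontalDefect hR hpos (hη X) (hη Y) (hη W)

end Differentials

end AlmostCosymplecticCalculus

/-! ### Smoothness of the Levi-Civita connection -/

section Smoothness

variable {E : Type*} [NormedAddCommGroup E] [NormedSpace ℝ E]
  {H : Type*} [TopologicalSpace H] {I : ModelWithCorners ℝ E H}
  {M : Type*} [TopologicalSpace M] [ChartedSpace H M] {p : M}

lemma contMDiffAt_det {ι : Type*} [Fintype ι] [DecidableEq ι] {G : M → Matrix ι ι ℝ}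
    (hG : ∀ i j, ContMDiffAt I 𝓘(ℝ, ℝ) ∞ (fun q ↦ G q i j) p) :
    ContMDiffAt I 𝓘(ℝ, ℝ) ∞ (fun q ↦ (G q).det) p := by
  simp only [Matrix.det_apply, Units.smul_def, zsmul_eq_mul]
  exact ContMDiffAt.sum fun σ _ ↦ contMDiffAt_const.mul (contMDiffAt_finsetProd fun i _ ↦ hG _ _)

/-- The solution of a linear system with smooth coefficients is smooth, by Cramer's rule. -/
lemma contMDiffAt_of_mulVec {ι : Type*} [Fintype ι] [DecidableEq ι] {G : M → Matrix ι ι ℝ}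
    {c : M → ι → ℝ} (hG : ∀ i j, ContMDiffAt I 𝓘(ℝ, ℝ) ∞ (fun q ↦ G q i j) p)
    (hc : ∀ i, ContMDiffAt I 𝓘(ℝ, ℝ) ∞ (fun q ↦ (G q).mulVec (c q) i) p)
    (hdet : (G p).det ≠ 0) (i : ι) : ContMDiffAt I 𝓘(ℝ, ℝ) ∞ (fun q ↦ c q i) p := by
  have hcr (q : M) : (G q).cramer ((G q).mulVec (c q)) i = (G q).det * c q i := by
    rw [Matrix.cramer_eq_adjugate_mulVec, Matrix.mulVec_mulVec, Matrix.adjugate_mul]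
    simp [Matrix.smul_mulVec]
  have h1 : ContMDiffAt I 𝓘(ℝ, ℝ) ∞ (fun q ↦ (G q).cramer ((G q).mulVec (c q)) i) p := by
    simp only [Matrix.cramer_apply]
    refine contMDiffAt_det fun j k ↦ ?_
    simp only [Matrix.updateCol_apply]
    split_ifs
    · exact hc j
    · exact hG j k
  have hd := contMDiffAt_det hG
  refine ((hd.inv₀ hdet).mul h1).congr_of_eventuallyEq ?_
  filter_upwards [hd.continuousAt.eventually_ne hdet] with q hq
  simp only [Pi.mul_apply, hcr]
  field_simp

variable [IsManifold I ∞ M]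

/-- The derivative of a smooth function along a smooth vector field is smooth. -/
lemma contMDiffAt_dirDeriv {X : (q : M) → TangentSpace I q} {f : M → ℝ}
    (hX : ContMDiffAt I I.tangent ∞ (fun q ↦ (⟨q, X q⟩ : TangentBundle I M)) p)
    (hf : ContMDiffAt I 𝓘(ℝ, ℝ) ∞ f p) : ContMDiffAt I 𝓘(ℝ, ℝ) ∞ (dirDeriv X f) p := by
  have h1 := hf.mfderiv_const (m := ∞) le_rfl
  have h2 := ContMDiffAt.clm_apply_of_inCoordinates (F₁ := E) (F₂ := ℝ) (b₁ := id) (b₂ := f)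
    (E₂ := TangentSpace 𝓘(ℝ, ℝ)) h1 hX hf
  exact (contMDiff_snd_tangentBundle_modelSpace ℝ 𝓘(ℝ, ℝ)).contMDiffAt.comp p h2

variable (g : ContMDiffRiemannianMetric I ∞ E (fun p : M ↦ TangentSpace I p))

lemma contMDiffAt_inner {X Y : (q : M) → TangentSpace I q}
    (hX : ContMDiffAt I I.tangent ∞ (fun q ↦ (⟨q, X q⟩ : TangentBundle I M)) p)
    (hY : ContMDiffAt I I.tangent ∞ (fun q ↦ (⟨q, Y q⟩ : TangentBundle I M)) p) :
    ContMDiffAt I 𝓘(ℝ, ℝ) ∞ (fun q ↦ g.inner q (X q) (Y q)) p := by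
  have : ContMDiffAt I (I.prod 𝓘(ℝ)) ∞
      (fun m ↦ TotalSpace.mk' ℝ (E := Bundle.Trivial M ℝ) m (g.inner m (X m) (Y m))) p :=
    ContMDiffAt.clm_bundle_apply₂ (F₁ := E) (F₂ := E) g.contMDiff.contMDiffAt hX hY
  simp only [contMDiffAt_totalSpace] at this
  exact this.2

variable [FiniteDimensional ℝ E]

/-- A vector field is smooth near `p` if its inner products with smooth local vector fields are. -/
lemma contMDiffAt_of_inner {X : (q : M) → TangentSpace I q}
    (h : ∀ Z : (q : M) → TangentSpace I q,
      (∀ᶠ q in nhds p, ContMDiffAt I I.tangent ∞ (fun q ↦ (⟨q, Z q⟩ : TangentBundle I M)) q) →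
      ContMDiffAt I 𝓘(ℝ, ℝ) ∞ (fun q ↦ g.inner q (X q) (Z q)) p) :
    ContMDiffAt I I.tangent ∞ (fun q ↦ (⟨q, X q⟩ : TangentBundle I M)) p := by
  classical
  let e := trivializationAt E (TangentSpace I : M → Type _) p
  let b := Module.Basis.ofVectorSpace ℝ E
  have hp : p ∈ e.baseSet := FiberBundle.mem_baseSet_trivializationAt E _ p
  let s := e.localFrame b
  let c (i) (q : M) : ℝ := e.localFrameCoeff I b i q (X q)
  have hs (i) {q : M} (hq : q ∈ e.baseSet) :
      ContMDiffAt I I.tangent ∞ (fun q ↦ (⟨q, s i q⟩ : TangentBundle I M)) q :=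
    contMDiffAt_localFrame_of_mem ∞ e b i hq
  rw [contMDiffAt_iff_localFrameCoeff (e := e) b hp]
  have hG (q : M) (v) : (Matrix.of fun i j ↦ g.inner q (s j q) (s i q)).mulVec v
      = fun i ↦ g.inner q (∑ j, v j • s j q) (s i q) := by
    ext i
    simp [Matrix.mulVec, dotProduct, mul_comm]
  refine contMDiffAt_of_mulVec (c := fun q i ↦ c i q)
    (G := fun q ↦ Matrix.of fun i j ↦ g.inner q (s j q) (s i q)) (fun i j ↦ ?_) (fun i ↦ ?_) ?_
  · exact contMDiffAt_inner g (hs j hp) (hs i hp)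
  · refine (h (s i) ?_).congr_of_eventuallyEq ?_
    · filter_upwards [e.open_baseSet.mem_nhds hp] with q hq using hs i hq
    · filter_upwards [e.open_baseSet.mem_nhds hp] with q hq
      rw [hG]
      have := e.eq_sum_localFrameCoeff_smul (I := I) (b := b) (s := X) hq
      conv_rhs => rw [this]
  · -- the Gram matrix of a basis is invertible
    intro h0
    obtain ⟨v, hv, hv0⟩ := Matrix.exists_mulVec_eq_zero_iff.2 h0
    rw [hG] at hv0
    apply hv
    obtain ⟨u, hu⟩ : ∃ u, u = ∑ j, v j • s j p := ⟨_, rfl⟩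
    rw [← hu] at hv0
    have hz : u = 0 := by
      by_contra hne
      refine (g.pos p u hne).ne' ?_
      have h1 : g.inner p u (∑ j, v j • s j p) = 0 := by
        rw [map_sum]
        refine Finset.sum_eq_zero fun k _ ↦ ?_
        have := congrFun hv0 k
        simp only [Pi.zero_apply] at this
        rw [map_smul, this, smul_zero]
      rwa [← hu] at h1
    have hli := (e.isLocalFrameOn_localFrame_baseSet I ∞ b).linearIndependent hp
    ext i
    exact Fintype.linearIndependent_iff.1 hli v (hu.symm.trans hz) i

lemma contMDiffAt_mlieBracket {X Y : (q : M) → TangentSpace I q}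
    (hX : ContMDiffAt I I.tangent ∞ (fun q ↦ (⟨q, X q⟩ : TangentBundle I M)) p)
    (hY : ContMDiffAt I I.tangent ∞ (fun q ↦ (⟨q, Y q⟩ : TangentBundle I M)) p) :
    ContMDiffAt I I.tangent ∞ (fun q ↦ (⟨q, mlieBracket I X Y q⟩ : TangentBundle I M)) p := by
  have : CompleteSpace E := FiniteDimensional.complete ℝ E
  have : IsManifold I (minSmoothness ℝ 2) M := by
    rw [minSmoothness_of_isRCLikeNormedField]
    exact IsManifold.of_le (n := ∞) ENat.LEInfty.out
  have : IsManifold I ((⊤ : ℕ∞) + 1) M := ‹IsManifold I ∞ M›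
  exact ContMDiffAt.mlieBracket_vectorField (m := ⊤) (n := ⊤) hX hY
    (by rw [minSmoothness_of_isRCLikeNormedField]; exact le_rfl)

variable {g}
variable {nabla : CovariantDerivative I E (fun p : M ↦ TangentSpace I p)}

lemma IsLeviCivita.sub_eq_mlieBracket [CompleteSpace E] (hn : IsLeviCivita g nabla)
    {X Y : (q : M) → TangentSpace I q}
    (hX : MDifferentiableAt I I.tangent (fun q ↦ (⟨q, X q⟩ : TangentBundle I M)) p)
    (hY : MDifferentiableAt I I.tangent (fun q ↦ (⟨q, Y q⟩ : TangentBundle I M)) p) :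
    nabla Y p (X p) - nabla X p (Y p) = mlieBracket I X Y p :=
  (CovariantDerivative.torsion_eq_zero_iff _).1 hn.torsion_eq_zero hX hY

/-- The Koszul formula. -/
lemma IsLeviCivita.koszul [CompleteSpace E] (hn : IsLeviCivita g nabla)
    {X Y Z : (q : M) → TangentSpace I q}
    (hX : MDifferentiableAt I I.tangent (fun q ↦ (⟨q, X q⟩ : TangentBundle I M)) p)
    (hY : MDifferentiableAt I I.tangent (fun q ↦ (⟨q, Y q⟩ : TangentBundle I M)) p)
    (hZ : MDifferentiableAt I I.tangent (fun q ↦ (⟨q, Z q⟩ : TangentBundle I M)) p) :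
    g.inner p (covDeriv nabla X Y p) (Z p) = (1 / 2 : ℝ) *
      (dirDeriv X (fun q ↦ g.inner q (Y q) (Z q)) p + dirDeriv Y (fun q ↦ g.inner q (X q) (Z q)) p
        - dirDeriv Z (fun q ↦ g.inner q (X q) (Y q)) p
        + g.inner p (mlieBracket I X Y p) (Z p) - g.inner p (mlieBracket I X Z p) (Y p)
        - g.inner p (mlieBracket I Y Z p) (X p)) := by
  simp only [dirDeriv, covDeriv]
  rw [hn.metric_compatible Y Z p hY hZ, hn.metric_compatible X Z p hX hZ,
    hn.metric_compatible X Y p hX hY, ← hn.sub_eq_mlieBracket hX hY, ← hn.sub_eq_mlieBracket hX hZ,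
    ← hn.sub_eq_mlieBracket hY hZ]
  simp only [map_sub, sub_apply]
  rw [g.symm p (nabla Z p (Y p)) (X p), g.symm p (nabla Z p (X p)) (Y p),
    g.symm p (nabla Y p (Z p)) (X p)]
  ring

/-- The Levi-Civita connection preserves smoothness. -/
lemma IsLeviCivita.isSmoothField_covDeriv [CompleteSpace E] (hn : IsLeviCivita g nabla)
    {X Y : (q : M) → TangentSpace I q} (hX : IsSmoothField X) (hY : IsSmoothField Y) :
    IsSmoothField (covDeriv nabla X Y) := by
  intro p
  refine contMDiffAt_of_inner g fun Z hZ ↦ ?_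
  have hXp := hX p
  have hYp := hY p
  have hZp := hZ.self_of_nhds
  have hK : ContMDiffAt I 𝓘(ℝ, ℝ) ∞ (fun p ↦ (1 / 2 : ℝ) *
      (dirDeriv X (fun q ↦ g.inner q (Y q) (Z q)) p + dirDeriv Y (fun q ↦ g.inner q (X q) (Z q)) p
        - dirDeriv Z (fun q ↦ g.inner q (X q) (Y q)) p
        + g.inner p (mlieBracket I X Y p) (Z p) - g.inner p (mlieBracket I X Z p) (Y p)
        - g.inner p (mlieBracket I Y Z p) (X p))) p :=
    contMDiffAt_const.mul ((((((contMDiffAt_dirDeriv hXp (contMDiffAt_inner g hYp hZp)).add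
      (contMDiffAt_dirDeriv hYp (contMDiffAt_inner g hXp hZp))).sub
      (contMDiffAt_dirDeriv hZp (contMDiffAt_inner g hXp hYp))).add
      (contMDiffAt_inner g (contMDiffAt_mlieBracket hXp hYp) hZp)).sub
      (contMDiffAt_inner g (contMDiffAt_mlieBracket hXp hZp) hYp)).sub
      (contMDiffAt_inner g (contMDiffAt_mlieBracket hYp hZp) hXp))
  refine hK.congr_of_eventuallyEq ?_
  filter_upwards [hZ] with q hq
  exact hn.koszul ((hX q).mdifferentiableAt (by simp)) ((hY q).mdifferentiableAt (by simp))
    (hq.mdifferentiableAt (by simp))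

end Smoothness

/-! ### The calculus of smooth vector fields on a manifold -/

section Calculus

variable {E : Type*} [NormedAddCommGroup E] [NormedSpace ℝ E]
  {H : Type*} [TopologicalSpace H] {I : ModelWithCorners ℝ E H}
  {M : Type*} [TopologicalSpace M] [ChartedSpace H M] [IsManifold I ∞ M]

variable (I M) in
/-- The smooth vector fields on `M`. -/
abbrev SmoothField : Type _ := Cₛ^∞⟮I; E, (TangentSpace I : M → Type _)⟯

variable (I M) in
/-- The smooth functions on `M`. -/
abbrev SmoothFun : Type _ := C^∞⟮I, M; 𝓘(ℝ, ℝ), ℝ⟯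

/-- Smooth functions act on smooth vector fields pointwise. -/
instance : Module (SmoothFun I M) (SmoothField I M) where
  smul f X := ⟨fun p ↦ f p • X p, f.contMDiff.smul_section X.contMDiff⟩
  one_smul X := ContMDiffSection.ext fun p ↦ one_smul ℝ (X p)
  mul_smul f f' X := ContMDiffSection.ext fun p ↦ mul_smul (f p) (f' p) (X p)
  smul_zero f := ContMDiffSection.ext fun p ↦ smul_zero (f p)
  smul_add f X Y := ContMDiffSection.ext fun p ↦ smul_add (f p) (X p) (Y p)
  add_smul f f' X := ContMDiffSection.ext fun p ↦ add_smul (f p) (f' p) (X p)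
  zero_smul X := ContMDiffSection.ext fun p ↦ zero_smul ℝ (X p)

/-- Evaluation of smooth functions at a point. -/
def evalAt (p : M) : SmoothFun I M →ₐ[ℝ] ℝ where
  toFun f := f p
  map_one' := rfl
  map_mul' _ _ := rfl
  map_zero' := rfl
  map_add' _ _ := rfl
  commutes' _ := rfl

omit [IsManifold I ∞ M] in
lemma SmoothFun.two_apply (p : M) : (2 : SmoothFun I M) p = 2 := map_ofNat (evalAt p) 2

omit [IsManifold I ∞ M] in
lemma SmoothFun.mdifferentiableAt (f : SmoothFun I M) (p : M) :
    MDifferentiableAt I 𝓘(ℝ, ℝ) f p :=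
  f.contMDiff.mdifferentiable (by simp) p

/-- A smooth vector field acts on smooth functions as a derivation. -/
def lieDerivation : SmoothField I M →ₗ[SmoothFun I M] Derivation ℝ (SmoothFun I M) (SmoothFun I M)
    where
  toFun X := Derivation.mk'
    { toFun := fun f ↦ ⟨dirDeriv X f, fun p ↦ contMDiffAt_dirDeriv (X.contMDiff p) (f.contMDiff p)⟩
      map_add' := fun f f' ↦ by
        ext p
        exact congrArg (fun L ↦ L (X p))
          (mvfderiv_add (f.mdifferentiableAt p) (f'.mdifferentiableAt p))
      map_smul' := fun c f ↦ by
        ext p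
        refine (congrArg (fun L ↦ L (X p)) (mvfderiv_mul (f := fun _ ↦ c)
          mdifferentiableAt_const (f.mdifferentiableAt p))).trans ?_
        simp [mvfderiv_const]
        rfl }
    fun f f' ↦ by
      ext p
      refine (congrArg (fun L ↦ L (X p))
        (mvfderiv_mul (f.mdifferentiableAt p) (f'.mdifferentiableAt p))).trans ?_
      simp
      rfl
  map_add' X Y := by
    ext f p
    exact map_add (mvfderiv I f p) (X p) (Y p)
  map_smul' a X := by
    ext f p
    exact map_smul (mvfderiv I f p) (a p) (X p)

end Calculus

/-! ### The calculus of an almost cosymplectic manifold -/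

section Manifold

variable {E : Type*} [NormedAddCommGroup E] [NormedSpace ℝ E] [FiniteDimensional ℝ E]
  [CompleteSpace E] {H : Type*} [TopologicalSpace H] {I : ModelWithCorners ℝ E H}
  {M : Type*} [TopologicalSpace M] [ChartedSpace H M] [IsManifold I ∞ M]

/-- The calculus of smooth vector fields on a Riemannian manifold. -/
def leviCivitaCalculus {g : ContMDiffRiemannianMetric I ∞ E (fun p : M ↦ TangentSpace I p)}
    {nabla : CovariantDerivative I E (fun p : M ↦ TangentSpace I p)}
    (hn : IsLeviCivita g nabla) : LeviCivitaCalculus (SmoothFun I M) (SmoothField I M) where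
  D := lieDerivation
  br X Y := ⟨mlieBracket I X Y, fun p ↦ contMDiffAt_mlieBracket (X.contMDiff p) (Y.contMDiff p)⟩
  nab :=
    { toFun := fun X ↦
        { toFun := fun Y ↦ ⟨covDeriv nabla X Y,
            hn.isSmoothField_covDeriv X.contMDiff Y.contMDiff⟩
          map_zero' := by
            ext p
            exact congrArg (fun L ↦ L p (X p)) (CovariantDerivative.zero nabla)
          map_add' := fun Y Z ↦ by
            ext p
            exact congrArg (fun L ↦ L (X p))
              (nabla.isCovariantDerivativeOn.add Y.mdifferentiableAt Z.mdifferentiableAt) }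
      map_add' := fun X Y ↦ by
        ext Z p
        exact map_add (nabla Z p) (X p) (Y p)
      map_smul' := fun f X ↦ by
        ext Z p
        exact map_smul (nabla Z p) (f p) (X p) }
  g := LinearMap.mk₂ _
    (fun X Y ↦ ⟨fun p ↦ g.inner p (X p) (Y p),
      fun p ↦ contMDiffAt_inner g (X.contMDiff p) (Y.contMDiff p)⟩)
    (fun X Y Z ↦ by
      ext p
      exact congrArg (fun L ↦ L (Z p)) (map_add (g.inner p) (X p) (Y p)))
    (fun f X Y ↦ by
      ext p
      exact congrArg (fun L ↦ L (Y p)) (map_smul (g.inner p) (f p) (X p)))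
    (fun X Y Z ↦ by
      ext p
      exact map_add (g.inner p (X p)) (Y p) (Z p))
    (fun f X Y ↦ by
      ext p
      exact map_smul (g.inner p (X p)) (f p) (Y p))
  nab_smul X f Y := by
    ext p
    exact congrArg (fun L ↦ L (X p))
      (nabla.isCovariantDerivativeOn.leibniz Y.mdifferentiableAt (f.mdifferentiableAt p))
  torsion_free X Y := by
    ext p
    exact hn.sub_eq_mlieBracket X.mdifferentiableAt Y.mdifferentiableAt
  jacobi X Y Z := by
    have h2 : minSmoothness ℝ 2 ≤ ∞ := by
      rw [minSmoothness_of_isRCLikeNormedField]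
      exact ENat.LEInfty.out
    have h3 : minSmoothness ℝ 3 ≤ ∞ := by
      rw [minSmoothness_of_isRCLikeNormedField]
      exact ENat.LEInfty.out
    have : IsManifold I (minSmoothness ℝ 3) M := IsManifold.of_le h3
    ext p
    exact leibniz_identity_mlieBracket_apply ((X.contMDiff p).of_le h2)
      ((Y.contMDiff p).of_le h2) ((Z.contMDiff p).of_le h2)
  g_symm X Y := by
    ext p
    exact g.symm p (X p) (Y p)
  g_def X h := by
    ext p
    by_contra hne
    exact (g.pos p (X p) hne).ne' (congrArg (fun f : SmoothFun I M ↦ f p) h)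
  D_g X Y Z := by
    ext p
    exact hn.metric_compatible Y Z p Y.mdifferentiableAt Z.mdifferentiableAt (X p)

/-- The calculus of smooth vector fields on an almost cosymplectic manifold. -/
def AlmostContactMetric.calculus {S : AlmostContactMetric I M} {α : ℝ}
    (hS : S.IsAlmostCosymplectic α)
    {nabla : CovariantDerivative I E (fun p : M ↦ TangentSpace I p)}
    (hn : IsLeviCivita S.g nabla) :
    AlmostCosymplecticCalculus (SmoothFun I M) (SmoothField I M) where
  toLeviCivitaCalculus := leviCivitaCalculus hn
  φ :=
    { toFun := fun X ↦ ⟨S.phi X, S.φ_smooth.clm_bundle_apply X.contMDiff⟩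
      map_add' := fun X Y ↦ by
        ext p
        exact map_add (S.φ p) (X p) (Y p)
      map_smul' := fun f X ↦ by
        ext p
        exact map_smul (S.φ p) (f p) (X p) }
  ξ := ⟨S.ξ, S.ξ_smooth⟩
  η :=
    { toFun := fun X ↦ ⟨S.eta X, fun p ↦ by
        have := S.η_smooth.clm_bundle_apply X.contMDiff p
        simp only [contMDiffAt_totalSpace] at this
        exact this.2⟩
      map_add' := fun X Y ↦ by
        ext p
        exact map_add (S.η p) (X p) (Y p)
      map_smul' := fun f X ↦ by
        ext p
        exact map_smul (S.η p) (f p) (X p) }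
  a := algebraMap ℝ _ α
  D_a X := Derivation.map_algebraMap _ α
  φ_sq X := by
    ext p
    exact S.φ_sq p (X p)
  η_ξ := by
    ext p
    exact S.η_ξ p
  compatible X Y := by
    ext p
    exact S.compatible p (X p) (Y p)
  dη X Y := by
    ext p
    exact congrFun (hS.dEta_eq_zero X Y X.contMDiff Y.contMDiff) p
  dΦ X Y Z := by
    ext p
    refine (congrFun (hS.dFundForm_eq X Y Z X.contMDiff Y.contMDiff Z.contMDiff) p).trans ?_
    rw [← SmoothFun.two_apply (I := I) p]
    rfl

end Manifold

end

end AlmostCosymplectic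

theorem mainTheorem7 (n : ℕ)
    {M : Type*} [TopologicalSpace M] [T2Space M]
    [ChartedSpace (EuclideanSpace ℝ (Fin (2 * n + 1))) M]
    [IsManifold (𝓡 (2 * n + 1)) ∞ M]
    (S : AlmostCosymplectic.AlmostContactMetric (𝓡 (2 * n + 1)) M)
    (α : ℝ) (hS : S.IsAlmostCosymplectic α)
    (nabla : CovariantDerivative (𝓡 (2 * n + 1)) (EuclideanSpace ℝ (Fin (2 * n + 1)))
      (fun p : M ↦ TangentSpace (𝓡 (2 * n + 1)) p))
    (hnabla : AlmostCosymplectic.IsLeviCivita S.g nabla)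
    (κ μ ν : M → ℝ)
    (hκ : ContMDiff (𝓡 (2 * n + 1)) 𝓘(ℝ, ℝ) ∞ κ)
    (hμ : ContMDiff (𝓡 (2 * n + 1)) 𝓘(ℝ, ℝ) ∞ μ)
    (hν : ContMDiff (𝓡 (2 * n + 1)) 𝓘(ℝ, ℝ) ∞ ν)
    (hR : S.IsNullity nabla κ μ ν)
    (X Y : (p : M) → TangentSpace (𝓡 (2 * n + 1)) p)
    (hX : AlmostCosymplectic.IsSmoothField X) (hY : AlmostCosymplectic.IsSmoothField Y)
    (p : M) :
    0 = AlmostCosymplectic.dirDeriv S.ξ κ p • (S.eta Y p • X p - S.eta X p • Y p)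
      + AlmostCosymplectic.dirDeriv S.ξ μ p • (S.eta Y p • S.h X p - S.eta X p • S.h Y p)
      + AlmostCosymplectic.dirDeriv S.ξ ν p •
          (S.eta Y p • S.phi (S.h X) p - S.eta X p • S.phi (S.h Y) p)
      - AlmostCosymplectic.dirDeriv X κ p • S.phi (S.phi Y) p
      + AlmostCosymplectic.dirDeriv X μ p • S.h Y p
      + AlmostCosymplectic.dirDeriv X ν p • S.phi (S.h Y) p
      - AlmostCosymplectic.dirDeriv Y μ p • S.h X p
      - AlmostCosymplectic.dirDeriv Y ν p • S.phi (S.h X) p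
      + AlmostCosymplectic.dirDeriv Y κ p • S.phi (S.phi X) p
      + (2 * (κ p + α ^ 2) * μ p * S.metric (S.phi X) Y p) • S.ξ p
      + (2 * μ p * S.metric (S.h X) (S.phi (S.h Y)) p) • S.ξ p := by
  let C := AlmostCosymplectic.AlmostContactMetric.calculus hS hnabla
  let κ' : AlmostCosymplectic.SmoothFun (𝓡 (2 * n + 1)) M := ⟨κ, hκ⟩
  let μ' : AlmostCosymplectic.SmoothFun (𝓡 (2 * n + 1)) M := ⟨μ, hμ⟩
  let ν' : AlmostCosymplectic.SmoothFun (𝓡 (2 * n + 1)) M := ⟨ν, hν⟩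
  let X' : AlmostCosymplectic.SmoothField (𝓡 (2 * n + 1)) M := ⟨X, hX⟩
  let Y' : AlmostCosymplectic.SmoothField (𝓡 (2 * n + 1)) M := ⟨Y, hY⟩
  have hR' : C.IsNullity κ' μ' ν' := fun X Y ↦ by
    ext q
    exact hR X Y X.contMDiff Y.contMDiff q
  have hpos (Z : AlmostCosymplectic.SmoothField (𝓡 (2 * n + 1)) M) : 0 ≤ AlmostCosymplectic.evalAt p (C.g Z Z) := by
    by_cases hZ : Z p = 0
    · have : AlmostCosymplectic.evalAt p (C.g Z Z) = S.g.inner p (Z p) (Z p) := rfl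
      rw [this, hZ, map_zero]
    · exact (S.g.pos p (Z p) hZ).le
  have h := AlmostCosymplectic.AlmostCosymplecticCalculus.ev_g_defect hR' hpos X' Y' (C.defect κ' μ' ν' X' Y')
  have h0 : C.defect κ' μ' ν' X' Y' p = 0 := by
    by_contra hne
    exact (S.g.pos p _ hne).ne' h
  have ha : α ^ 2 = (C.a ^ 2) p := (map_pow (AlmostCosymplectic.evalAt p) C.a 2).symm
  rw [ha, ← AlmostCosymplectic.SmoothFun.two_apply (I := 𝓡 (2 * n + 1)) p]
  exact h0.symm
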